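/- Binary probability forecasting with side information is the following game. Fix $d\ge 1$ and put $\mathcal K_0=1$, $\mathcal S_0=0\in\mathbb R^d$, $\mathcal V_0=0\in\mathbb R^{d\times d}$. On each day $n=1,2,\dots$ Forecaster announces $p_n\in(0,1)$ and $c_n\in\mathbb R^d$, Skeptic announces $M_n\in\mathbb R$, Reality announces $x_n\in\{0,1\}$, and $$\mathcal K_n=\mathcal K_{n-1}+M_n(x_n-p_n),\quad \mathcal S_n=\mathcal S_{n-1}+c_n(x_n-p_n),\quad \mathcal V_n=\mathcal V_{n-1}+c_nc_n'\,p_n(1-p_n).$$ A path is a sequence $\xi=p_1c_1x_1p_2c_2x_2\dots$; an event is a set of paths. A strategy $\mathcal P$ of Skeptic determines a number $\hat p_n$ from $p_1c_1x_1\dots p_{n-1}c_{n-1}x_{n-1}p_nc_n$, and Skeptic then bets $M_n=\nu_n\mathcal K_{n-1}$ with $\nu_n=(\hat p_n-p_n)/(p_n(1-p_n))$; $\mathcal K_n^{\mathcal P}(\xi)$ denotes the resulting capital. By $\mathcal P$ Skeptic weakly forces the conditional event $E_1\Rightarrow E_2$ if $\mathcal K_n^{\mathcal P}(\xi)\ge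 0$ for all $n$ and all paths $\xi$, and $\limsup_n\mathcal K_n^{\mathcal P}(\xi)=\infty$ for every $\xi\in E_1\setminus E_2$. For $\theta\in\mathbb R^d$ let $$\hat p_i^{\theta}=\frac{p_ie^{\theta'c_i}}{1+p_i(e^{\theta'c_i}-1)},$$ that is, $\log\frac{\hat p_i^\theta}{1-\hat p_i^\theta}=\log\frac{p_i}{1-p_i}+\theta'c_i$. The Bayesian logistic strategy with prior density $\pi$ on $\mathbb R^d$ is $$\hat p_n=\frac{\hat p(x_1,\dots,x_{n-1},1)}{\hat p(x_1,\dots,x_{n-1})},\qquad \hat p(x_1,\dots,x_n)=\int_{\mathbb R^d}\prod_{i=1}^n(\hat p_i^\theta)^{x_i}(1-\hat p_i^\theta)^{1-x_i}\,\pi(\theta)\,d\theta .$$ **Theorem.** Let $\pi$ be a probability density on $\mathbb R^d$ that is bounded below by a positive constant on some neighborhood of the origin (for instance, a density that is continuous and positive near the origin). Let $E_1$ be the set of paths such that $\lim_n\lambda_{\min}(\mathcal V_n)=\infty$, $\limsup_n\lambda_{\max}(\mathcal V_n)/\lambda_{\min}(\mathcal V_n)<\infty$ and $c_1,c_2,\dots$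 is bounded, where $\lambda_{\min}$ and $\lambda_{\max}$ denote the smallest and largest eigenvalues. Then, by the Bayesian logistic strategy with prior density $\pi$, Skeptic weakly forces $$E_1\ \Rightarrow\ \limsup_{n}\frac{\mathcal S_n'\mathcal V_n^{-1}\mathcal S_n}{\log\det\mathcal V_n}\le 1 .$$ -/

import Mathlib

/-! Binary probability forecasting game with side information.  Day `n` of the game
(`n = 1, 2, …`) has index `n - 1` in a path, so days `1, …, n` are `Finset.range n`. -/

namespace BPFSI

open Filter Topology MeasureTheory

/-- A move of Forecaster: a probability `p ∈ (0, 1)` and side information `c ∈ ℝ^d`. -/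
structure Forecast (d : ℕ) where
  p : ℝ
  c : Fin d → ℝ
  p_pos : 0 < p
  p_lt_one : p < 1

/-- One day of the game: Forecaster's move and Reality's move (`true` is `x = 1`). -/
structure Round (d : ℕ) where
  forecast : Forecast d
  outcome : Bool

/-- A path `p₁ c₁ x₁ p₂ c₂ x₂ …`. -/
abbrev Path (d : ℕ) := ℕ → Round d

/-- Forecaster's probability. -/
def Round.p {d : ℕ} (r : Round d) : ℝ := r.forecast.p

/-- The side information. -/
def Round.c {d : ℕ} (r : Round d) : Fin d → ℝ := r.forecast.c

/-- Reality's move as a real number `0` or `1`. -/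
def Round.x {d : ℕ} (r : Round d) : ℝ := if r.outcome then 1 else 0

/-- The moves of Forecaster and Reality on days `1, …, n`, in this order. -/
def Path.history {d : ℕ} (ξ : Path d) (n : ℕ) : List (Round d) := (List.range n).map ξ

/-- `𝒮ₙ = ∑_{i ≤ n} cᵢ (xᵢ - pᵢ)`. -/
def Path.S {d : ℕ} (ξ : Path d) (n : ℕ) : Fin d → ℝ :=
  ∑ i ∈ Finset.range n, ((ξ i).x - (ξ i).p) • (ξ i).c

/-- `𝒱ₙ = ∑_{i ≤ n} cᵢ cᵢ' pᵢ (1 - pᵢ)`. -/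
def Path.V {d : ℕ} (ξ : Path d) (n : ℕ) : Matrix (Fin d) (Fin d) ℝ :=
  ∑ i ∈ Finset.range n, ((ξ i).p * (1 - (ξ i).p)) • Matrix.vecMulVec (ξ i).c (ξ i).c

theorem Path.V_isHermitian {d : ℕ} (ξ : Path d) (n : ℕ) : (ξ.V n).IsHermitian := by
  ext j k
  simp only [Path.V, Matrix.conjTranspose_apply, Matrix.sum_apply, Matrix.smul_apply,
    Matrix.vecMulVec_apply, smul_eq_mul, star_trivial]
  exact Finset.sum_congr rfl fun i _ => by ring

/-- The largest eigenvalue of `𝒱ₙ` (for `d ≥ 1`). -/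
noncomputable def Path.lambdaMax {d : ℕ} (ξ : Path d) (n : ℕ) : ℝ :=
  ⨆ i, (ξ.V_isHermitian n).eigenvalues i

/-- The smallest eigenvalue of `𝒱ₙ` (for `d ≥ 1`). -/
noncomputable def Path.lambdaMin {d : ℕ} (ξ : Path d) (n : ℕ) : ℝ :=
  ⨅ i, (ξ.V_isHermitian n).eigenvalues i

/-- A strategy of Skeptic: the moves of the preceding days and Forecaster's current move
`pₙ cₙ` determine Skeptic's own success probability `p̂ₙ`. -/
abbrev Strategy (d : ℕ) := List (Round d) → Forecast d → ℝ

/-- The betting ratio `νₙ = (p̂ₙ - pₙ) / (pₙ (1 - pₙ))` of the Kelly criterion. -/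
noncomputable def bettingRatio {d : ℕ} (P : Strategy d) (h : List (Round d)) (f : Forecast d) : ℝ :=
  (P h f - f.p) / (f.p * (1 - f.p))

/-- Skeptic's capital: `𝒦₀ = 1`, `𝒦ₙ = 𝒦ₙ₋₁ + Mₙ (xₙ - pₙ)` with `Mₙ = νₙ 𝒦ₙ₋₁` tickets. -/
noncomputable def capital {d : ℕ} (P : Strategy d) (ξ : Path d) : ℕ → ℝ
  | 0 => 1
  | n + 1 => capital P ξ n +
      (bettingRatio P (ξ.history n) (ξ n).forecast * capital P ξ n) * ((ξ n).x - (ξ n).p)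

/-- By the strategy `P`, Skeptic weakly forces the event `E`. -/
def WeaklyForces {d : ℕ} (P : Strategy d) (E : Set (Path d)) : Prop :=
  (∀ ξ n, 0 ≤ capital P ξ n) ∧
    ∀ ξ, ξ ∉ E → limsup (fun n => ((capital P ξ n : ℝ) : EReal)) atTop = ⊤

/-- The conditional event `E₁ ⇒ E₂`. -/
def conditionalEvent {d : ℕ} (E₁ E₂ : Set (Path d)) : Set (Path d) := E₁ᶜ ∪ E₂

/-- The success probability in the logistic regression model with parameter `θ`, i.e. the
solution `p̂` of `log (p̂ / (1 - p̂)) = log (p / (1 - p)) + θ'c`. -/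
noncomputable def logisticProb {d : ℕ} (θ : Fin d → ℝ) (f : Forecast d) : ℝ :=
  f.p * Real.exp (θ ⬝ᵥ f.c) / (1 + f.p * (Real.exp (θ ⬝ᵥ f.c) - 1))

/-- `p̂(x₁, …, xₙ)` for the logistic model with parameter `θ`:
the product over the days of `p̂ᵢ^{xᵢ} (1 - p̂ᵢ)^{1 - xᵢ}`. -/
noncomputable def logisticLikelihood {d : ℕ} (θ : Fin d → ℝ) (h : List (Round d)) : ℝ :=
  (h.map fun r =>
    if r.outcome then logisticProb θ r.forecast else 1 - logisticProb θ r.forecast).prod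

/-- The joint probability `p̂(x₁, …, xₙ)` under the prior density `π`. -/
noncomputable def bayesJointProb {d : ℕ} (π : (Fin d → ℝ) → ℝ) (h : List (Round d)) : ℝ :=
  ∫ θ, logisticLikelihood θ h * π θ

/-- The Bayesian logistic strategy with prior density `π`:
`p̂ₙ = p̂(x₁, …, xₙ₋₁, 1) / p̂(x₁, …, xₙ₋₁)`. -/
noncomputable def bayesLogistic {d : ℕ} (π : (Fin d → ℝ) → ℝ) : Strategy d := fun h f =>
  bayesJointProb π (h ++ [⟨f, true⟩]) / bayesJointProb π h

/-- `π` is a probability density with respect to Lebesgue measure on `ℝ^d`. -/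
structure IsPriorDensity {d : ℕ} (π : (Fin d → ℝ) → ℝ) : Prop where
  nonneg : ∀ θ, 0 ≤ π θ
  integrable : Integrable π
  integral_eq_one : ∫ θ, π θ = 1

/-- `π` supports a neighborhood of the origin: it is bounded below by a positive constant there.
This holds in particular if `π` is continuous at the origin and `π 0 > 0`. -/
def SupportsOrigin {d : ℕ} (π : (Fin d → ℝ) → ℝ) : Prop :=
  ∃ δ > 0, ∀ᶠ θ in 𝓝 (0 : Fin d → ℝ), δ ≤ π θ

/-- The regularity conditions: `λ_min → ∞`, `limsup λ_max / λ_min < ∞`, and bounded `cₙ`. -/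
def regularityEvent (d : ℕ) : Set (Path d) :=
  {ξ | Tendsto ξ.lambdaMin atTop atTop ∧
    limsup (fun n => ((ξ.lambdaMax n / ξ.lambdaMin n : ℝ) : EReal)) atTop < ⊤ ∧
    Bornology.IsBounded (Set.range fun n => (ξ n).c)}

/-- The event `limsup 𝒮ₙ' 𝒱ₙ⁻¹ 𝒮ₙ / log det 𝒱ₙ ≤ 1`. -/
noncomputable def rateEvent (d : ℕ) : Set (Path d) :=
  {ξ | limsup (fun n =>
    ((ξ.S n ⬝ᵥ ((ξ.V n)⁻¹.mulVec (ξ.S n)) / Real.log (ξ.V n).det : ℝ) : EReal)) atTop ≤ 1}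

end BPFSI

namespace BPFSI

open Filter Topology MeasureTheory

open scoped Matrix

/-! ### The logistic model and the capital process -/

section Capital

variable {d : ℕ}

/-! Kelly betting makes the capital the likelihood ratio of the Bayesian mixture against Forecaster
(`IsPriorDensity.capital_mul`). For `θ` near the origin the log-likelihood ratio is at least `θ'S -
(1 + ε)/2 θ'Vθ` (`Path.exp_le_likelihood_ratio`). Integrating over an ellipsoidal cell of volume
`(det V)^(-1/2)` near the vertex `V⁻¹S/(1 + ε)` of this quadratic bounds the capital below by a
constant times `exp(Q/(2(1 + ε))) / √(det V)`, where `Q = S'V⁻¹S`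
(`le_integral_of_quadratic_lower_bound`). If `Q ≥ (1 + κ) log det V` infinitely often, this is
unbounded.

The vertex may lie outside the ball where the quadratic bound and the prior bound hold. The centre
is then pulled back towards the origin by a factor `s`. Since `Q ≥ λ_min |V⁻¹S|²`, the exponent
still grows linearly in `λ_min`, whereas the eigenvalue ratio condition keeps `log det V` of order
`log λ_min`. -/

theorem logistic_denom_pos (f : Forecast d) (t : ℝ) : 0 < 1 + f.p * (Real.exp t - 1) := by
  have := mul_pos f.p_pos (Real.exp_pos t)
  linarith [f.p_lt_one]

theorem logisticProb_pos (θ : Fin d → ℝ) (f : Forecast d) : 0 < logisticProb θ f :=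
  div_pos (mul_pos f.p_pos (Real.exp_pos _)) (logistic_denom_pos f _)

theorem one_sub_logisticProb (θ : Fin d → ℝ) (f : Forecast d) :
    1 - logisticProb θ f = (1 - f.p) / (1 + f.p * (Real.exp (θ ⬝ᵥ f.c) - 1)) := by
  have := (logistic_denom_pos f (θ ⬝ᵥ f.c)).ne'
  rw [logisticProb]
  field_simp
  ring

theorem logisticProb_lt_one (θ : Fin d → ℝ) (f : Forecast d) : logisticProb θ f < 1 := by
  have : 0 < 1 - logisticProb θ f := by
    rw [one_sub_logisticProb]
    exact div_pos (by linarith [f.p_lt_one]) (logistic_denom_pos f _)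
  linarith

theorem logisticProb_zero (f : Forecast d) : logisticProb 0 f = f.p := by
  simp [logisticProb]

theorem continuous_logisticProb (f : Forecast d) : Continuous fun θ => logisticProb θ f := by
  unfold logisticProb
  have h : Continuous fun θ : Fin d → ℝ => θ ⬝ᵥ f.c := by
    unfold dotProduct
    fun_prop
  refine Continuous.div (by fun_prop) (by fun_prop) fun θ => (logistic_denom_pos f _).ne'

theorem logisticLikelihood_append_singleton (θ : Fin d → ℝ) (h : List (Round d)) (r : Round d) :
    logisticLikelihood θ (h ++ [r]) = logisticLikelihood θ h *
      (if r.outcome then logisticProb θ r.forecast else 1 - logisticProb θ r.forecast) := by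
  simp [logisticLikelihood]

theorem logisticLikelihood_pos (θ : Fin d → ℝ) (h : List (Round d)) :
    0 < logisticLikelihood θ h := by
  induction h using List.reverseRecOn with
  | nil => simp [logisticLikelihood]
  | append_singleton h r ih =>
    rw [logisticLikelihood_append_singleton]
    split_ifs
    · exact mul_pos ih (logisticProb_pos _ _)
    · exact mul_pos ih (by linarith [logisticProb_lt_one θ r.forecast])

theorem logisticLikelihood_le_one (θ : Fin d → ℝ) (h : List (Round d)) :
    logisticLikelihood θ h ≤ 1 := by
  induction h using List.reverseRecOn with
  | nil => simp [logisticLikelihood]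
  | append_singleton h r ih =>
    rw [logisticLikelihood_append_singleton]
    have h1 := logisticProb_lt_one θ r.forecast
    have h2 := logisticProb_pos θ r.forecast
    split_ifs
    · exact mul_le_one₀ ih h2.le h1.le
    · exact mul_le_one₀ ih (by linarith) (by linarith)

theorem continuous_logisticLikelihood (h : List (Round d)) :
    Continuous fun θ => logisticLikelihood θ h := by
  induction h using List.reverseRecOn with
  | nil => simpa [logisticLikelihood] using continuous_const
  | append_singleton h r ih =>
    simp_rw [logisticLikelihood_append_singleton]
    split_ifs
    · exact ih.mul (continuous_logisticProb _)
    · exact ih.mul (continuous_const.sub (continuous_logisticProb _))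

variable {π : (Fin d → ℝ) → ℝ}

theorem IsPriorDensity.integrable_likelihood_mul (hπ : IsPriorDensity π) (h : List (Round d)) :
    Integrable fun θ => logisticLikelihood θ h * π θ := by
  refine hπ.integrable.bdd_mul (c := 1) (continuous_logisticLikelihood h).aestronglyMeasurable ?_
  refine Eventually.of_forall fun θ => ?_
  rw [Real.norm_of_nonneg (logisticLikelihood_pos θ h).le]
  exact logisticLikelihood_le_one θ h

/-- Likelihoods are strictly positive, so a vanishing integral would force `π = 0` almost
everywhere, against total mass 1. This makes the predictive quotient meaningful. -/
theorem IsPriorDensity.bayesJointProb_pos (hπ : IsPriorDensity π) (h : List (Round d)) :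
    0 < bayesJointProb π h := by
  have hnn : 0 ≤ fun θ => logisticLikelihood θ h * π θ := fun θ =>
    mul_nonneg (logisticLikelihood_pos θ h).le (hπ.nonneg θ)
  refine lt_of_le_of_ne (integral_nonneg hnn) fun h0 => ?_
  have h1 := (integral_eq_zero_iff_of_nonneg hnn (hπ.integrable_likelihood_mul h)).1 h0.symm
  have h2 : π =ᵐ[volume] 0 := by
    filter_upwards [h1] with θ hθ
    exact (mul_eq_zero.1 hθ).resolve_left (logisticLikelihood_pos θ h).ne'
  have h3 := integral_congr_ae h2
  simp [hπ.integral_eq_one] at h3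

theorem IsPriorDensity.bayesJointProb_append_add (hπ : IsPriorDensity π) (h : List (Round d))
    (f : Forecast d) :
    bayesJointProb π (h ++ [⟨f, true⟩]) + bayesJointProb π (h ++ [⟨f, false⟩]) =
      bayesJointProb π h := by
  unfold bayesJointProb
  rw [← integral_add (hπ.integrable_likelihood_mul _) (hπ.integrable_likelihood_mul _)]
  refine integral_congr_ae (Eventually.of_forall fun θ => ?_)
  simp only [logisticLikelihood_append_singleton]
  simp only [if_true, Bool.false_eq_true, if_false]
  ring

theorem Path.history_succ (ξ : Path d) (n : ℕ) : ξ.history (n + 1) = ξ.history n ++ [ξ n] := by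
  simp [Path.history, List.range_succ]

/-- The capital is the likelihood ratio of the Bayesian mixture against Forecaster. -/
theorem IsPriorDensity.capital_mul (hπ : IsPriorDensity π) (ξ : Path d) (n : ℕ) :
    capital (bayesLogistic π) ξ n * logisticLikelihood 0 (ξ.history n) =
      bayesJointProb π (ξ.history n) := by
  induction n with
  | zero => simp [capital, Path.history, bayesJointProb, logisticLikelihood, hπ.integral_eq_one]
  | succ n ih =>
    have hB := (hπ.bayesJointProb_pos (ξ.history n)).ne'
    have hadd := hπ.bayesJointProb_append_add (ξ.history n) (ξ n).forecast
    rw [Path.history_succ, logisticLikelihood_append_singleton, capital, bettingRatio,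
      bayesLogistic, logisticProb_zero]
    have hp := (ξ n).forecast.p_pos.ne'
    have hp1 : (1 - (ξ n).forecast.p) ≠ 0 := by linarith [(ξ n).forecast.p_lt_one]
    generalize ξ n = r at *
    obtain ⟨f, x⟩ := r
    dsimp only at hadd hp hp1 ⊢
    -- The capital is multiplied by `p̂/p` on outcome 1 and by `(1 - p̂)/(1 - p)` on outcome 0; in
    -- the latter case `hadd` supplies the complementary mixture mass.
    cases x
    · rw [← eq_sub_iff_add_eq'] at hadd
      rw [hadd, ← ih] at *
      simp only [Round.x, Round.p, Bool.false_eq_true, if_false]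
      have hK := left_ne_zero_of_mul hB
      have hL := right_ne_zero_of_mul hB
      field_simp
      ring
    · rw [← ih] at hB ⊢
      simp only [Round.x, Round.p, if_true]
      have hK := left_ne_zero_of_mul hB
      have hL := right_ne_zero_of_mul hB
      field_simp
      ring

theorem IsPriorDensity.capital_eq_integral (hπ : IsPriorDensity π) (ξ : Path d) (n : ℕ) :
    capital (bayesLogistic π) ξ n = ∫ θ, logisticLikelihood θ (ξ.history n) /
      logisticLikelihood 0 (ξ.history n) * π θ := by
  rw [eq_div_of_mul_eq (logisticLikelihood_pos 0 _).ne' (hπ.capital_mul ξ n), bayesJointProb,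
    ← integral_div]
  simp only [div_mul_eq_mul_div]

theorem IsPriorDensity.capital_nonneg (hπ : IsPriorDensity π) (ξ : Path d) (n : ℕ) :
    0 ≤ capital (bayesLogistic π) ξ n := by
  rw [hπ.capital_eq_integral]
  exact integral_nonneg fun θ => mul_nonneg
    (div_nonneg (logisticLikelihood_pos _ _).le (logisticLikelihood_pos _ _).le) (hπ.nonneg θ)

end Capital

/-! ### A quadratic lower bound for the log-likelihood ratio -/

/-- Taylor's cubic remainder is at most `(2/9)|x|³`, which `|x| ≤ ε` absorbs into `(ε/2)x²`. -/
theorem exp_le_one_add_add_sq {x ε : ℝ} (hε : ε ≤ 1) (hx : |x| ≤ ε) :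
    Real.exp x ≤ 1 + x + (1 + ε) / 2 * x ^ 2 := by
  have h := (abs_le.1 (Real.exp_bound (hx.trans hε) (n := 3) (by norm_num))).2
  norm_num [Finset.sum_range_succ, Nat.factorial] at h
  have h3 : |x| ^ 3 ≤ ε * x ^ 2 := by
    rw [pow_succ' |x| 2, sq_abs]
    exact mul_le_mul_of_nonneg_right hx (sq_nonneg x)
  have h0 : 0 ≤ ε * x ^ 2 := mul_nonneg ((abs_nonneg x).trans hx) (sq_nonneg x)
  linarith

/-- After division by `exp(pt)` the left side is the moment generating function of a centred
Bernoulli variable: the linear terms cancel and the quadratic ones add up to the variance `p(1 -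
p)`. -/
theorem one_add_mul_exp_sub_one_le {p t ε : ℝ} (hp : 0 ≤ p) (hp1 : p ≤ 1) (hε : ε ≤ 1)
    (ht : |t| ≤ ε) :
    1 + p * (Real.exp t - 1) ≤ Real.exp (p * t + (1 + ε) / 2 * (p * (1 - p) * t ^ 2)) := by
  have h1 := exp_le_one_add_add_sq (x := -(p * t)) hε (by
    rw [abs_neg, abs_mul, abs_of_nonneg hp]
    exact (mul_le_of_le_one_left (abs_nonneg t) hp1).trans ht)
  have h2 := exp_le_one_add_add_sq (x := (1 - p) * t) hε (by
    rw [abs_mul, abs_of_nonneg (sub_nonneg.2 hp1)]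
    exact (mul_le_of_le_one_left (abs_nonneg t) (by linarith)).trans ht)
  have h3 := Real.add_one_le_exp ((1 + ε) / 2 * (p * (1 - p) * t ^ 2))
  have h4 : (1 - p) * Real.exp (-(p * t)) + p * Real.exp ((1 - p) * t) ≤
      Real.exp ((1 + ε) / 2 * (p * (1 - p) * t ^ 2)) := by
    refine le_trans ?_ h3
    refine (add_le_add (mul_le_mul_of_nonneg_left h1 (sub_nonneg.2 hp1))
      (mul_le_mul_of_nonneg_left h2 hp)).trans (le_of_eq ?_)
    ring
  rw [Real.exp_add]
  refine le_trans (le_of_eq ?_) (mul_le_mul_of_nonneg_left h4 (Real.exp_pos (p * t)).le)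
  have e1 : Real.exp (p * t) * Real.exp (-(p * t)) = 1 := by rw [← Real.exp_add]; simp
  have e2 : Real.exp (p * t) * Real.exp ((1 - p) * t) = Real.exp t := by
    rw [← Real.exp_add]; ring_nf
  linear_combination (p - 1) * e1 - p * e2

section Likelihood

variable {d : ℕ}

theorem Path.S_succ (ξ : Path d) (n : ℕ) :
    ξ.S (n + 1) = ξ.S n + ((ξ n).x - (ξ n).p) • (ξ n).c := Finset.sum_range_succ _ _

theorem Path.V_succ (ξ : Path d) (n : ℕ) :
    ξ.V (n + 1) = ξ.V n + ((ξ n).p * (1 - (ξ n).p)) • Matrix.vecMulVec (ξ n).c (ξ n).c :=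
  Finset.sum_range_succ _ _

theorem Path.exp_le_likelihood_ratio (ξ : Path d) {θ : Fin d → ℝ} {ε : ℝ} (hε : ε ≤ 1)
    (hθ : ∀ i, |θ ⬝ᵥ (ξ i).c| ≤ ε) (n : ℕ) :
    Real.exp (θ ⬝ᵥ ξ.S n - (1 + ε) / 2 * (θ ⬝ᵥ (ξ.V n *ᵥ θ))) ≤
      logisticLikelihood θ (ξ.history n) / logisticLikelihood 0 (ξ.history n) := by
  induction n with
  | zero => simp [Path.S, Path.V, Path.history, logisticLikelihood]
  | succ n ih =>
    have hp := (ξ n).forecast.p_pos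
    have hp1 := (ξ n).forecast.p_lt_one
    have hpc : 0 < 1 - (ξ n).forecast.p := by linarith
    have key := one_add_mul_exp_sub_one_le hp.le hp1.le hε (hθ n)
    have hD := logistic_denom_pos (ξ n).forecast (θ ⬝ᵥ (ξ n).c)
    rw [Path.history_succ, logisticLikelihood_append_singleton,
      logisticLikelihood_append_singleton, mul_div_mul_comm, one_sub_logisticProb, logisticProb_zero,
      logisticProb]
    have hexp : θ ⬝ᵥ ξ.S (n + 1) - (1 + ε) / 2 * (θ ⬝ᵥ (ξ.V (n + 1) *ᵥ θ)) =
        (θ ⬝ᵥ ξ.S n - (1 + ε) / 2 * (θ ⬝ᵥ (ξ.V n *ᵥ θ))) + ((ξ n).x * (θ ⬝ᵥ (ξ n).c) -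
        ((ξ n).forecast.p * (θ ⬝ᵥ (ξ n).c) + (1 + ε) / 2 * ((ξ n).forecast.p *
          (1 - (ξ n).forecast.p) * (θ ⬝ᵥ (ξ n).c) ^ 2))) := by
      rw [Path.S_succ, Path.V_succ, dotProduct_add, Matrix.add_mulVec, dotProduct_add,
        dotProduct_smul, Matrix.smul_mulVec, dotProduct_smul, Matrix.vecMulVec_mulVec,
        dotProduct_comm (ξ n).c θ]
      simp only [op_smul_eq_smul, dotProduct_smul, smul_eq_mul, Round.p]
      ring
    rw [hexp, Real.exp_add]
    refine mul_le_mul ih ?_ (Real.exp_pos _).le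
      (div_nonneg (logisticLikelihood_pos _ _).le (logisticLikelihood_pos _ _).le)
    rw [Real.exp_sub]
    have hc : (ξ n).forecast.c = (ξ n).c := rfl
    rw [hc]
    have hx : (if (ξ n).outcome then
        (ξ n).forecast.p * Real.exp (θ ⬝ᵥ (ξ n).c) /
          (1 + (ξ n).forecast.p * (Real.exp (θ ⬝ᵥ (ξ n).c) - 1))
        else (1 - (ξ n).forecast.p) / (1 + (ξ n).forecast.p * (Real.exp (θ ⬝ᵥ (ξ n).c) - 1))) /
        (if (ξ n).outcome then (ξ n).forecast.p else 1 - (ξ n).forecast.p) =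
        Real.exp ((ξ n).x * (θ ⬝ᵥ (ξ n).c)) /
          (1 + (ξ n).forecast.p * (Real.exp (θ ⬝ᵥ (ξ n).c) - 1)) := by
      rw [Round.x]
      split_ifs
      · rw [one_mul]; field_simp
      · rw [zero_mul, Real.exp_zero]; field_simp
    rw [hx]
    exact div_le_div_of_nonneg_left (Real.exp_pos _).le hD key

end Likelihood

/-! ### Positive definite matrices -/

section PosDef

variable {m : Type*} [Fintype m] [DecidableEq m]

open scoped MatrixOrder in
theorem exists_eq_transpose_mul_self {V : Matrix m m ℝ} (hV : V.PosSemidef) :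
    ∃ B : Matrix m m ℝ, V = Bᵀ * B := by
  obtain ⟨B, hB⟩ := CStarAlgebra.nonneg_iff_eq_star_mul_self.1 hV.nonneg
  exact ⟨B, by rw [hB, Matrix.star_eq_conjTranspose, Matrix.conjTranspose_eq_transpose_of_trivial]⟩

open scoped MatrixOrder in
/-- The Rayleigh bound: a lower bound of the eigenvalues bounds the quadratic form from below. -/
theorem mul_dotProduct_self_le_of_le_eigenvalues {V : Matrix m m ℝ} (hV : V.IsHermitian) {r : ℝ}
    (hr : ∀ i, r ≤ hV.eigenvalues i) (x : m → ℝ) : r * (x ⬝ᵥ x) ≤ x ⬝ᵥ (V *ᵥ x) := by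
  have h : algebraMap ℝ (Matrix m m ℝ) r ≤ V := by
    rw [algebraMap_le_iff_le_spectrum (ha := hV.isSelfAdjoint)]
    intro y hy
    obtain ⟨i, rfl⟩ := hV.spectrum_real_eq_range_eigenvalues ▸ hy
    exact hr i
  have h2 := (Matrix.le_iff.1 h).dotProduct_mulVec_nonneg x
  rw [Algebra.algebraMap_eq_smul_one, Matrix.sub_mulVec, Matrix.smul_mulVec, Matrix.one_mulVec,
    star_trivial, dotProduct_sub, dotProduct_smul, smul_eq_mul] at h2
  linarith

end PosDef

/-! ### A Laplace-type lower bound -/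

section Laplace

variable {d : ℕ}

/-- The unit cube in the orthant of `w`. -/
def orthantCube (w : Fin d → ℝ) : Set (Fin d → ℝ) :=
  Set.Icc (fun i => if 0 ≤ w i then 0 else -1) (fun i => if 0 ≤ w i then 1 else 0)

theorem volume_orthantCube (w : Fin d → ℝ) : volume (orthantCube w) = 1 := by
  rw [orthantCube, Real.volume_Icc_pi]
  refine Finset.prod_eq_one fun i _ => ?_
  split_ifs <;> simp

theorem dotProduct_nonneg_of_mem_orthantCube {w z : Fin d → ℝ} (hz : z ∈ orthantCube w) :
    0 ≤ w ⬝ᵥ z := by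
  refine Finset.sum_nonneg fun i _ => ?_
  have h1 := hz.1 i
  have h2 := hz.2 i
  dsimp only at h1 h2
  split_ifs at h1 h2 with h
  · exact mul_nonneg h h1
  · exact mul_nonneg_of_nonpos_of_nonpos (not_le.1 h).le h2

theorem dotProduct_self_le_of_mem_orthantCube {w z : Fin d → ℝ} (hz : z ∈ orthantCube w) :
    z ⬝ᵥ z ≤ d := by
  have : ∀ i ∈ Finset.univ, z i * z i ≤ (1 : ℝ) := fun i _ => by
    have h1 := hz.1 i
    have h2 := hz.2 i
    dsimp only at h1 h2
    rw [← abs_mul_self, abs_mul]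
    have : |z i| ≤ 1 := by
      rw [abs_le]
      split_ifs at h1 h2 <;> constructor <;> linarith
    exact mul_le_one₀ this (abs_nonneg _) this
  simpa [dotProduct] using Finset.sum_le_card_nsmul _ _ _ this

/-- Write `V = BᵀB` and integrate only over `u + B⁻¹(cube)`, with `u = (s/a)V⁻¹S`. At `s = 1` the
centre is the vertex of the quadratic; smaller `s` keeps the cell inside the ball. -/
theorem le_integral_of_quadratic_lower_bound {V : Matrix (Fin d) (Fin d) ℝ} (hV : V.PosDef)
    {G : (Fin d → ℝ) → ℝ} (hG0 : 0 ≤ G) (hG : Integrable G) {S : Fin d → ℝ} {a s δ ρ r : ℝ}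
    (ha : 0 < a) (hs : s ≤ 1) (hδ : 0 ≤ δ) (hr : 0 < r)
    (hVr : ∀ x, r * (x ⬝ᵥ x) ≤ x ⬝ᵥ (V *ᵥ x))
    (hGS : ∀ θ, θ ⬝ᵥ θ ≤ ρ → δ * Real.exp (θ ⬝ᵥ S - a / 2 * (θ ⬝ᵥ (V *ᵥ θ))) ≤ G θ)
    (hu : (s / a) ^ 2 * ((V⁻¹ *ᵥ S) ⬝ᵥ (V⁻¹ *ᵥ S)) ≤ ρ / 4) (hdr : d / r ≤ ρ / 4) :
    δ * Real.exp ((s - s ^ 2 / 2) / a * (S ⬝ᵥ (V⁻¹ *ᵥ S)) - a / 2 * d) / Real.sqrt V.det ≤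
      ∫ θ, G θ := by
  obtain ⟨B, hB⟩ := exists_eq_transpose_mul_self hV.posSemidef
  have hdetV : V.det = B.det ^ 2 := by
    rw [hB, Matrix.det_mul, Matrix.det_transpose, sq]
  have hVdet : 0 < V.det := hV.det_pos
  have hBdet : B.det ≠ 0 := fun h => by simp [h] at hdetV; linarith
  have hBu : IsUnit B.det := isUnit_iff_ne_zero.2 hBdet
  have hVu : IsUnit V.det := isUnit_iff_ne_zero.2 hVdet.ne'
  have hVT : Vᵀ = V := by rw [hB, Matrix.transpose_mul, Matrix.transpose_transpose]
  set g := V⁻¹ *ᵥ S with hg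
  have hVg : V *ᵥ g = S := by rw [hg, Matrix.mulVec_mulVec, Matrix.mul_nonsing_inv _ hVu,
    Matrix.one_mulVec]
  set u := (s / a) • g with hu'
  set w := (B⁻¹)ᵀ *ᵥ S with hw
  set A := (fun h => u + h) '' (Matrix.toLin' B⁻¹ '' orthantCube w) with hA
  have hAc : IsCompact A := by
    refine (isCompact_Icc.image ?_).image (by fun_prop)
    exact LinearMap.continuous_of_finiteDimensional _
  have hvol : volume.real A = (Real.sqrt V.det)⁻¹ := by
    rw [hA, Set.image_add_left, measureReal_def, measure_preimage_add, Measure.addHaar_image_linearMap,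
      volume_orthantCube, mul_one, ENNReal.toReal_ofReal (abs_nonneg _), LinearMap.det_toLin',
      Matrix.det_nonsing_inv, Ring.inverse_eq_inv', hdetV, Real.sqrt_sq_eq_abs, abs_inv]
  have hle : ∀ θ ∈ A, δ * Real.exp ((s - s ^ 2 / 2) / a * (S ⬝ᵥ g) - a / 2 * d) ≤ G θ := by
    rintro _ ⟨_, ⟨z, hz, rfl⟩, rfl⟩
    dsimp only
    rw [Matrix.toLin'_apply]
    set h := B⁻¹ *ᵥ z with hh
    have hhV : h ⬝ᵥ (V *ᵥ h) = z ⬝ᵥ z := by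
      have : B *ᵥ h = z := by
        rw [hh, Matrix.mulVec_mulVec, Matrix.mul_nonsing_inv _ hBu, Matrix.one_mulVec]
      rw [hB, ← Matrix.mulVec_mulVec, Matrix.dotProduct_mulVec, Matrix.vecMul_transpose, this]
    have hzd := dotProduct_self_le_of_mem_orthantCube hz
    have hhS : h ⬝ᵥ S = w ⬝ᵥ z := by
      rw [hw, hh, dotProduct_comm _ S, Matrix.dotProduct_mulVec, Matrix.mulVec_transpose]
    have hwz := dotProduct_nonneg_of_mem_orthantCube hz
    have hhh : h ⬝ᵥ h ≤ ρ / 4 := by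
      refine le_trans ?_ hdr
      rw [le_div_iff₀ hr]
      linarith [hVr h]
    have huu : u ⬝ᵥ u ≤ ρ / 4 := by
      rw [hu', dotProduct_smul, smul_dotProduct, smul_eq_mul, smul_eq_mul]
      linarith
    have hρ : (u + h) ⬝ᵥ (u + h) ≤ ρ := by
      -- This gives `|u + h|² ≤ 2|u|² + 2|h|²`, hence the two thresholds `ρ/4`.
      have h0 : 0 ≤ (u - h) ⬝ᵥ (u - h) := Finset.sum_nonneg fun i _ => mul_self_nonneg _
      rw [sub_dotProduct, dotProduct_sub, dotProduct_sub, dotProduct_comm h u] at h0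
      rw [add_dotProduct, dotProduct_add, dotProduct_add, dotProduct_comm h u]
      linarith
    refine le_trans (mul_le_mul_of_nonneg_left (Real.exp_le_exp.2 ?_) hδ) (hGS _ hρ)
    have huV : V *ᵥ u = (s / a) • S := by rw [hu', Matrix.mulVec_smul, hVg]
    have hux : u ⬝ᵥ (V *ᵥ h) = (s / a) * (h ⬝ᵥ S) := by
      rw [Matrix.dotProduct_mulVec, ← Matrix.mulVec_transpose, hVT, huV, smul_dotProduct,
        dotProduct_comm, smul_eq_mul]
    rw [Matrix.mulVec_add, add_dotProduct, add_dotProduct, dotProduct_add, dotProduct_add, hux,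
      huV, hhV, hhS, dotProduct_smul, dotProduct_smul, hhS, hu', smul_dotProduct, smul_eq_mul,
      smul_eq_mul, smul_eq_mul, dotProduct_comm g S]
    -- Off the vertex a linear term `(1 - s)(w ⬝ᵥ z)` survives; it is nonnegative because the cube
    -- lies in the orthant of `w`.
    have e : s / a * (S ⬝ᵥ g) + w ⬝ᵥ z - a / 2 * (s / a * (s / a * (S ⬝ᵥ g)) +
        s / a * (w ⬝ᵥ z) + (s / a * (w ⬝ᵥ z) + z ⬝ᵥ z)) =
        (s - s ^ 2 / 2) / a * (S ⬝ᵥ g) + (1 - s) * (w ⬝ᵥ z) - a / 2 * (z ⬝ᵥ z) := by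
      field_simp
      ring
    have h1 := mul_nonneg (sub_nonneg.2 hs) hwz
    have h2 := mul_le_mul_of_nonneg_left hzd (half_pos ha).le
    linarith
  have h1 := setIntegral_ge_of_const_le_real hAc.measurableSet hAc.measure_lt_top.ne hle
    hG.integrableOn
  rw [hvol, ← div_eq_mul_inv] at h1
  exact h1.trans (setIntegral_le_integral hG (Eventually.of_forall hG0))

end Laplace

/-! ### Growth of the capital -/

section Growth

variable {d : ℕ}

theorem Path.lambdaMin_le (ξ : Path d) (n : ℕ) (i : Fin d) :
    ξ.lambdaMin n ≤ (ξ.V_isHermitian n).eigenvalues i :=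
  ciInf_le (Set.finite_range _).bddBelow i

theorem Path.le_lambdaMax (ξ : Path d) (n : ℕ) (i : Fin d) :
    (ξ.V_isHermitian n).eigenvalues i ≤ ξ.lambdaMax n :=
  le_ciSup (Set.finite_range _).bddAbove i

theorem Path.det_V (ξ : Path d) (n : ℕ) :
    (ξ.V n).det = ∏ i, (ξ.V_isHermitian n).eigenvalues i := by
  simpa using (ξ.V_isHermitian n).det_eq_prod_eigenvalues

theorem Path.posDef_V {ξ : Path d} {n : ℕ} (h : 0 < ξ.lambdaMin n) : (ξ.V n).PosDef :=
  (ξ.V_isHermitian n).posDef_iff_eigenvalues_pos.2 fun i => h.trans_le (ξ.lambdaMin_le n i)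

theorem Path.log_lambdaMin_le {ξ : Path d} {n : ℕ} (h : 0 < ξ.lambdaMin n) :
    d * Real.log (ξ.lambdaMin n) ≤ Real.log (ξ.V n).det := by
  rw [← Real.log_pow, ξ.det_V]
  refine Real.log_le_log (pow_pos h d) ?_
  simpa using Finset.prod_le_prod (s := Finset.univ) (fun _ _ => h.le)
    fun i _ => ξ.lambdaMin_le n i

theorem Path.log_det_le {ξ : Path d} {n : ℕ} (h : 0 < ξ.lambdaMin n) {C : ℝ}
    (hC : ξ.lambdaMax n ≤ C) : Real.log (ξ.V n).det ≤ d * Real.log C := by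
  rw [← Real.log_pow]
  refine Real.log_le_log (Path.posDef_V h).det_pos ?_
  rw [ξ.det_V]
  simpa using Finset.prod_le_prod (s := Finset.univ)
    (fun i _ => h.le.trans (ξ.lambdaMin_le n i)) fun i _ => (ξ.le_lambdaMax n i).trans hC

theorem norm_le_of_dotProduct_self_le {θ : Fin d → ℝ} {r : ℝ} (hr : 0 ≤ r)
    (h : θ ⬝ᵥ θ ≤ r ^ 2) : ‖θ‖ ≤ r := by
  refine (pi_norm_le_iff_of_nonneg hr).2 fun i => abs_le_of_sq_le_sq ?_ hr
  refine le_trans ?_ h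
  rw [sq]
  exact Finset.single_le_sum (f := fun i => θ i * θ i) (fun j _ => mul_self_nonneg _)
    (Finset.mem_univ i)

theorem abs_dotProduct_le (θ c : Fin d → ℝ) : |θ ⬝ᵥ c| ≤ d * (‖θ‖ * ‖c‖) := by
  refine (Finset.abs_sum_le_sum_abs _ _).trans ?_
  have : ∀ i ∈ Finset.univ, |θ i * c i| ≤ ‖θ‖ * ‖c‖ := fun i _ => by
    rw [abs_mul]
    exact mul_le_mul (norm_le_pi_norm θ i) (norm_le_pi_norm c i) (abs_nonneg _) (norm_nonneg _)
  simpa using Finset.sum_le_card_nsmul _ _ _ this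

/-- The ambient norm is the sup norm, whereas the Laplace bound uses Euclidean balls; bounded side
information makes one radius serve every day. -/
theorem exists_prior_ball {π : (Fin d → ℝ) → ℝ} (hπ0 : SupportsOrigin π) {ξ : Path d}
    (hc : Bornology.IsBounded (Set.range fun n => (ξ n).c)) {ε : ℝ} (hε : 0 < ε) :
    ∃ δ > 0, ∃ ρ > 0, ∀ θ : Fin d → ℝ, θ ⬝ᵥ θ ≤ ρ → δ ≤ π θ ∧ ∀ i, |θ ⬝ᵥ (ξ i).c| ≤ ε := by
  obtain ⟨δ, hδ, hπδ⟩ := hπ0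
  -- Below, `d + 1` in place of `d` keeps the divisor positive even for `d = 0`.
  obtain ⟨r, hr, hball⟩ := Metric.eventually_nhds_iff.1 hπδ
  obtain ⟨R, hR, hcR⟩ := hc.exists_pos_norm_le
  have hdR : 0 < (d + 1) * R := by positivity
  set q := min (r / 2) (ε / ((d + 1) * R)) with hq
  have hq0 : 0 < q := lt_min (half_pos hr) (div_pos hε hdR)
  refine ⟨δ, hδ, q ^ 2, pow_pos hq0 2, fun θ hθ => ?_⟩
  have hθq := norm_le_of_dotProduct_self_le hq0.le hθ
  refine ⟨hball ?_, fun i => (abs_dotProduct_le _ _).trans ?_⟩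
  · rw [dist_zero_right]
    linarith [min_le_left (r / 2) (ε / ((d + 1) * R))]
  · have h1 : ‖θ‖ ≤ ε / ((d + 1) * R) := hθq.trans (min_le_right _ _)
    rw [le_div_iff₀ hdR] at h1
    have h2 := mul_le_mul_of_nonneg_left (hcR _ ⟨i, rfl⟩) (norm_nonneg θ)
    have h3 : (d : ℝ) * (‖θ‖ * ‖(ξ i).c‖) ≤ d * (‖θ‖ * R) :=
      mul_le_mul_of_nonneg_left h2 d.cast_nonneg
    have h4 : 0 ≤ ‖θ‖ * R := by positivity
    linarith

/-- The mixture bound for the capital, for any shrinking factor `s` of the maximizer. -/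
theorem IsPriorDensity.le_capital {π : (Fin d → ℝ) → ℝ} (hπ : IsPriorDensity π) {ξ : Path d}
    {n : ℕ} {ε δ ρ s : ℝ} (hε : 0 ≤ ε) (hε1 : ε ≤ 1) (hδ : 0 ≤ δ)
    (hρ : ∀ θ : Fin d → ℝ, θ ⬝ᵥ θ ≤ ρ → δ ≤ π θ ∧ ∀ i, |θ ⬝ᵥ (ξ i).c| ≤ ε)
    (hn : 0 < ξ.lambdaMin n) (hs : s ≤ 1) (hdr : d / ξ.lambdaMin n ≤ ρ / 4)
    (hu : (s / (1 + ε)) ^ 2 * (((ξ.V n)⁻¹ *ᵥ ξ.S n) ⬝ᵥ ((ξ.V n)⁻¹ *ᵥ ξ.S n)) ≤ ρ / 4) :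
    δ * Real.exp ((s - s ^ 2 / 2) / (1 + ε) * (ξ.S n ⬝ᵥ ((ξ.V n)⁻¹ *ᵥ ξ.S n)) - (1 + ε) / 2 * d) /
      Real.sqrt (ξ.V n).det ≤ capital (bayesLogistic π) ξ n := by
  rw [hπ.capital_eq_integral]
  have hint : Integrable fun θ => logisticLikelihood θ (ξ.history n) /
      logisticLikelihood 0 (ξ.history n) * π θ := by
    simpa only [div_mul_eq_mul_div] using (hπ.integrable_likelihood_mul _).div_const _
  refine le_integral_of_quadratic_lower_bound (Path.posDef_V hn) (fun θ => mul_nonneg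
    (div_nonneg (logisticLikelihood_pos _ _).le (logisticLikelihood_pos _ _).le) (hπ.nonneg θ))
    hint (by linarith) hs hδ hn
    (mul_dotProduct_self_le_of_le_eigenvalues (ξ.V_isHermitian n) (ξ.lambdaMin_le n)) ?_ hu hdr
  intro θ hθ
  rw [mul_comm]
  exact mul_le_mul (ξ.exp_le_likelihood_ratio hε1 (hρ θ hθ).2 n) (hρ θ hθ).1 hδ
    (div_nonneg (logisticLikelihood_pos _ _).le (logisticLikelihood_pos _ _).le)

theorem eventually_add_log_le_mul (A B : ℝ) {c : ℝ} (hc : 0 < c) :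
    ∀ᶠ x : ℝ in atTop, A + B * Real.log x ≤ c * x := by
  have h1 : (fun x : ℝ => A + B * Real.log x) =o[atTop] (id : ℝ → ℝ) :=
    (Asymptotics.isLittleO_const_id_atTop A).add (Real.isLittleO_log_id_atTop.const_mul_left B)
  filter_upwards [h1.bound hc, eventually_ge_atTop 0] with x hx hx0
  rw [id, Real.norm_of_nonneg hx0] at hx
  exact (le_abs_self _).trans hx

/-- The threshold on `n` must not depend on the position of the vertex, so the conditions needed for
the unshrunk and the shrunk centre are imposed together. -/
theorem IsPriorDensity.eventually_le_capital {π : (Fin d → ℝ) → ℝ} (hπ : IsPriorDensity π)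
    (hπ0 : SupportsOrigin π) (hd : 1 ≤ d) {ξ : Path d} (hξ : ξ ∈ regularityEvent d) {κ : ℝ}
    (hκ : 0 < κ) {M : ℝ} (hM : 0 < M) :
    ∀ᶠ n in atTop, (1 + κ) * Real.log (ξ.V n).det ≤ ξ.S n ⬝ᵥ ((ξ.V n)⁻¹ *ᵥ ξ.S n) →
      M ≤ capital (bayesLogistic π) ξ n := by
  obtain ⟨hmin, hratio, hc⟩ := hξ
  obtain ⟨C, hC1, -⟩ := EReal.lt_iff_exists_real_btwn.1 hratio
  set ε := min 1 (κ / 2) with hεdef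
  have hε : 0 < ε := lt_min one_pos (half_pos hκ)
  have hε1 : ε ≤ 1 := min_le_left _ _
  have hεκ : ε ≤ κ / 2 := min_le_right _ _
  obtain ⟨δ, hδ, ρ, hρ0, hρ⟩ := exists_prior_ball hπ0 hc hε
  -- The exponent must exceed `N + l/2`: `N` pays for `M`, the prior bound `δ` and the loss `(1 +
  -- ε)d/2 ≤ d`, and `l/2` for `√(det V)`.
  set N := Real.log M - Real.log δ + d with hN
  have hd1 : (1 : ℝ) ≤ d := by exact_mod_cast hd
  filter_upwards [eventually_lt_of_limsup_lt hC1, hmin.eventually_ge_atTop 1,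
    hmin.eventually_ge_atTop (4 * d / ρ),
    (Real.tendsto_log_atTop.comp hmin).eventually_ge_atTop (8 * N / κ),
    hmin.eventually (eventually_add_log_le_mul (N + d / 2 * Real.log (max C 1)) (d / 2)
      (by positivity : 0 < ρ / 8))] with n hCn h1 h4 h8 hlog hQ
  have hn : 0 < ξ.lambdaMin n := one_pos.trans_le h1
  have hmax : ξ.lambdaMax n ≤ max C 1 * ξ.lambdaMin n := by
    have := (EReal.coe_lt_coe_iff.1 hCn).le
    rw [div_le_iff₀ hn] at this
    exact this.trans (mul_le_mul_of_nonneg_right (le_max_left _ _) hn.le)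
  have hVpd := Path.posDef_V hn
  have hVu : IsUnit (ξ.V n).det := isUnit_iff_ne_zero.2 hVpd.det_pos.ne'
  have hdr : d / ξ.lambdaMin n ≤ ρ / 4 := by
    rw [div_le_iff₀ hρ0] at h4
    rw [div_le_iff₀ hn]
    linarith
  have hl1 := Path.log_lambdaMin_le hn
  have hl2 := Path.log_det_le hn hmax
  rw [Real.log_mul (one_pos.trans_le (le_max_right C 1)).ne' hn.ne'] at hl2
  have hlog0 : 0 ≤ Real.log (ξ.lambdaMin n) := Real.log_nonneg h1
  have hl3 : Real.log (ξ.lambdaMin n) ≤ Real.log (ξ.V n).det :=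
    (le_mul_of_one_le_left hlog0 hd1).trans hl1
  set l := Real.log (ξ.V n).det with hl
  set g := (ξ.V n)⁻¹ *ᵥ ξ.S n with hg
  set Q := ξ.S n ⬝ᵥ g with hQdef
  have hgQ : ξ.lambdaMin n * (g ⬝ᵥ g) ≤ Q := by
    have h := mul_dotProduct_self_le_of_le_eigenvalues (ξ.V_isHermitian n) (ξ.lambdaMin_le n) g
    rwa [hg, Matrix.mulVec_mulVec, Matrix.mul_nonsing_inv _ hVu, Matrix.one_mulVec,
      dotProduct_comm _ (ξ.S n)] at h
  have hgg : 0 ≤ g ⬝ᵥ g := Finset.sum_nonneg fun i _ => mul_self_nonneg _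
  have ha : 0 < 1 + ε := by linarith
  suffices h : ∃ s ≤ 1, (s / (1 + ε)) ^ 2 * (g ⬝ᵥ g) ≤ ρ / 4 ∧
      N + l / 2 ≤ (s - s ^ 2 / 2) / (1 + ε) * Q by
    obtain ⟨s, hs, hu, hsQ⟩ := h
    refine le_trans ?_ (hπ.le_capital hε.le hε1 hδ.le hρ hn hs hdr hu)
    rw [Real.sqrt_eq_rpow, Real.rpow_def_of_pos hVpd.det_pos, mul_div_assoc, ← Real.exp_sub]
    nth_rewrite 1 [← Real.exp_log hδ]
    rw [← Real.exp_add, ← Real.log_le_iff_le_exp hM]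
    have : (1 + ε) / 2 * d ≤ d := mul_le_of_le_one_left (by linarith) (by linarith)
    linarith
  -- If the vertex is within radius `√ρ/2`, take `s = 1`: the surplus is at least `l(κ - ε)/(2(1 +
  -- ε)) ≥ lκ/8`, which exceeds `N` by `h8`.
  by_cases hcase : (1 / (1 + ε)) ^ 2 * (g ⬝ᵥ g) ≤ ρ / 4
  · refine ⟨1, le_rfl, hcase, ?_⟩
    rw [div_le_iff₀ hκ] at h8
    have h8' : 8 * N ≤ l * κ := h8.trans (mul_le_mul_of_nonneg_right hl3 hκ.le)
    rw [div_mul_eq_mul_div, le_div_iff₀ ha]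
    have hl0 : 0 ≤ l := hlog0.trans hl3
    have hlε : l * ε ≤ l * (κ / 2) := mul_le_mul_of_nonneg_left hεκ hl0
    have h9 : N * (1 + ε) ≤ l * κ / 8 * (1 + ε) := mul_le_mul_of_nonneg_right (by linarith) ha.le
    have h10 : l * κ * ε ≤ l * κ := mul_le_of_le_one_right (by positivity) hε1
    linarith
  · rw [not_le] at hcase
    have hgpos : 0 < g ⬝ᵥ g := by
      refine lt_of_le_of_ne hgg fun h => ?_
      rw [← h, mul_zero] at hcase
      linarith
    set q := (1 / (1 + ε)) ^ 2 * (g ⬝ᵥ g) with hq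
    have hq0 : 0 < q := by positivity
    -- This `s` puts the centre exactly at radius `√ρ/2`. Then `s - s²/2 ≥ s²/2` and `Q ≥ λ_min
    -- |g|²` give an exponent of at least `(ρ/8)λ_min`, which beats `N + l/2` by `hlog`.
    set s := Real.sqrt (ρ / 4 / q) with hs
    have hs2 : s ^ 2 = ρ / 4 / q := Real.sq_sqrt (by positivity)
    have hs1 : s ≤ 1 := Real.sqrt_le_one.2 ((div_le_one hq0).2 hcase.le)
    have hs0 : 0 ≤ s := Real.sqrt_nonneg _
    have hsq : s ^ 2 * q = ρ / 4 := by rw [hs2]; field_simp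
    have hss : s ^ 2 ≤ s := by rw [sq]; exact mul_le_of_le_one_left hs0 hs1
    have hsq' : s ^ 2 * (g ⬝ᵥ g) = ρ / 4 * (1 + ε) ^ 2 := by
      rw [← hsq, hq]; field_simp
    refine ⟨s, hs1, ?_, ?_⟩
    · rw [div_pow, div_mul_eq_mul_div, hsq']
      exact (mul_div_cancel_right₀ _ (by positivity)).le
    · have e1 : s ^ 2 / 2 * (ξ.lambdaMin n * (g ⬝ᵥ g)) ≤ (s - s ^ 2 / 2) * Q :=
        mul_le_mul (by linarith) hgQ (by positivity) (by linarith [sq_nonneg s])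
      have e2 : ρ / 8 * ξ.lambdaMin n * (1 + ε) ≤ (s - s ^ 2 / 2) * Q := by
        refine le_trans ?_ e1
        have : s ^ 2 / 2 * (ξ.lambdaMin n * (g ⬝ᵥ g)) =
            ρ / 8 * ξ.lambdaMin n * (1 + ε) * (1 + ε) := by
          linear_combination (ξ.lambdaMin n / 2) * hsq'
        rw [this]
        exact le_mul_of_one_le_right (by positivity) (by linarith)
      have e3 : ρ / 8 * ξ.lambdaMin n ≤ (s - s ^ 2 / 2) / (1 + ε) * Q := by
        rwa [div_mul_eq_mul_div (s - s ^ 2 / 2), le_div_iff₀ ha]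
      refine le_trans ?_ e3
      linarith

theorem IsPriorDensity.limsup_capital_eq_top {π : (Fin d → ℝ) → ℝ} (hπ : IsPriorDensity π)
    (hπ0 : SupportsOrigin π) (hd : 1 ≤ d) {ξ : Path d} (hξ : ξ ∈ regularityEvent d)
    (hrate : ξ ∉ rateEvent d) :
    limsup (fun n => ((capital (bayesLogistic π) ξ n : ℝ) : EReal)) atTop = ⊤ := by
  obtain ⟨b, hb1, hb⟩ := EReal.lt_iff_exists_real_btwn.1 (not_le.1 hrate)
  have hb1' : 1 < b := by exact_mod_cast hb1
  have hfreq := frequently_lt_of_lt_limsup (by isBoundedDefault) hb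
  rw [EReal.eq_top_iff_forall_lt]
  intro M
  have hM : (M : EReal) < ((|M| + 1 : ℝ) : EReal) :=
    EReal.coe_lt_coe_iff.2 (by linarith [le_abs_self M])
  refine hM.trans_le (le_limsup_of_frequently_le ?_ (by isBoundedDefault))
  have hev := hπ.eventually_le_capital hπ0 hd hξ (sub_pos.2 hb1')
    (by positivity : 0 < |M| + 1)
  -- Requiring `λ_min > 1` makes `log det V` positive, so the inequality between quotients can be
  -- cleared of its denominator.
  refine (hfreq.and_eventually (hev.and (hξ.1.eventually_gt_atTop 1))).mono ?_
  rintro n ⟨h1, h2, h3⟩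
  refine EReal.coe_le_coe_iff.2 (h2 ?_)
  have hn := one_pos.trans h3
  have hl : 0 < Real.log (ξ.V n).det := lt_of_lt_of_le
    (mul_pos (by exact_mod_cast hd) (Real.log_pos h3)) (Path.log_lambdaMin_le hn)
  rw [EReal.coe_lt_coe_iff, lt_div_iff₀ hl] at h1
  linarith

end Growth

end BPFSI

theorem mainTheorem1 (d : ℕ) (hd : 1 ≤ d) (π : (Fin d → ℝ) → ℝ)
    (hπ : BPFSI.IsPriorDensity π) (hπ0 : BPFSI.SupportsOrigin π) :
    BPFSI.WeaklyForces (BPFSI.bayesLogistic π)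
      (BPFSI.conditionalEvent (BPFSI.regularityEvent d) (BPFSI.rateEvent d)) := by
  refine ⟨hπ.capital_nonneg, fun ξ hξ => ?_⟩
  rw [BPFSI.conditionalEvent, Set.mem_union, not_or, Set.notMem_compl_iff] at hξ
  exact hπ.limsup_capital_eq_top hπ0 hd hξ.1 hξ.2
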